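/- Let $(\Omega,\mathcal F,\mathbb P)$ be an atomless probability space and let $L^\infty\subseteq\mathcal X\subseteq L^0(\Omega,\mathcal F,\mathbb P)$ (for instance $\mathcal X=L^0$). Let $\rho:\mathcal X\to\mathbb R\cup\{\infty\}$ be a law-invariant exposure measure, i.e. a map that is monotone ($X\le Y$ a.s. implies $\rho(X)\le\rho(Y)$), cash-additive ($\rho(X+c)=\rho(X)+c$ for $c\in\mathbb R$ whenever $X,X+c\in\mathcal X$) and depends on $X$ only through its distribution function $F_X$, so that one may write $\rho(X)=\rho(F_X)$. Assume $\rho(0)<\infty$. For $n\ge 1$ and a sample $\mathbf x=(x^1,\dots,x^n)\in\mathbb R^n$ put $\widehat\rho(\mathbf x)=\rho(F_{\mathbf x})$, where $F_{\mathbf x}(s)=\frac1n\sum_{i=1}^n\mathbf 1_{\{s\ge x^i\}}$ is the empirical distribution function. Let $a<b$, $V_t:[a,b]\to\mathbb R$ and $N\ge 1$. Let $\tau(z)=b+\frac{a-b}{2}(1-z)$ be the affine map with $\tau([-1,1])=[a,b]$, and let $U_t$ be the degree-$N$ Chebyshev interpolant of $V_t$: $U_t=q\circ\tau^{-1}$,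 where $q$ is the polynomial of degree at most $N$ with $q(\zeta^k)=V_t(\tau(\zeta^k))$ at the Chebyshev points $\zeta^k=\cos(\pi k/N)$, $k=0,\dots,N$. For arbitrary market scenarios $z^1,\dots,z^n\in[a,b]$ let $\mathbf x_t=(\max\{V_t(z^i),0\})_{i=1}^n$ and $\mathbf y_t=(\max\{U_t(z^i),0\})_{i=1}^n$ be the realized exposures. Then the following hold. 1. Let $\varrho>1$ and let $\mathcal E_\varrho=\tau(\mathcal E)$, where $\mathcal E\subset\mathbb C$ is the open region bounded by the ellipse with foci $\pm1$ whose semi-axes sum to $\varrho$. If $V_t$ extends to an analytic function on $\mathcal E_\varrho$ whose absolute value is bounded there by $C$, then $\widehat\rho(\mathbf x_t)$ and $\widehat\rho(\mathbf y_t)$ are finite and $$\left|\widehat\rho(\mathbf x_t)-\widehat\rho(\mathbf y_t)\right|\le 4C\,\frac{\varrho^{-N}}{\varrho-1}.$$ 2. Let $p$ be an integer with $1\le p<N$ and let $C\ge 0$. If $V_t,V_t',\dots,V_t^{(p-1)}$ are absolutely continuous on $[a,b]$ and $V_t^{(p)}$ (which then exists almost everywhere) agrees almost everywhere on $[a,b]$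 with a function of total variation at most $C$ on $[a,b]$, then $\widehat\rho(\mathbf x_t)$ and $\widehat\rho(\mathbf y_t)$ are finite and $$\left|\widehat\rho(\mathbf x_t)-\widehat\rho(\mathbf y_t)\right|\le\frac{4C}{\pi p}\left(\frac{b-a}{2(N-p)}\right)^p.$$ -/

import Mathlib

open MeasureTheory Set

/-- A measure is atomless if every measurable set of positive measure has a measurable subset
of strictly smaller positive measure. (Mathlib's `NoAtoms` only says that points are null sets.) -/
def IsAtomless {Ω : Type*} [MeasurableSpace Ω] (P : Measure Ω) : Prop :=
  ∀ A : Set Ω, MeasurableSet A → 0 < P A → ∃ B ⊆ A, MeasurableSet B ∧ 0 < P B ∧ P B < P A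

/-- An exposure measure on a class `𝒳` of (almost sure equivalence classes of) random variables:
a monotone and cash-additive map into `ℝ ∪ {∞}`. Nothing is required of, and nothing is read off
from, the values outside `𝒳`. The choice `𝒳 = univ` gives exposure measures on all of `L⁰`. -/
structure ExposureMeasure {Ω : Type*} [MeasurableSpace Ω] (P : Measure Ω)
    (𝒳 : Set (Ω →ₘ[P] ℝ)) where
  toFun : (Ω →ₘ[P] ℝ) → WithTop ℝ
  monotone : ∀ X ∈ 𝒳, ∀ Y ∈ 𝒳, X ≤ Y → toFun X ≤ toFun Y
  cash_additive : ∀ X ∈ 𝒳, ∀ c : ℝ, X + AEEqFun.const Ω c ∈ 𝒳 →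
    toFun (X + AEEqFun.const Ω c) = toFun X + (c : WithTop ℝ)

/-- The distribution function `F_X(s) = P(X ≤ s)`. -/
noncomputable def distFun {Ω : Type*} [MeasurableSpace Ω] {P : Measure Ω}
    (X : Ω →ₘ[P] ℝ) (s : ℝ) : ℝ :=
  P.real {ω | X ω ≤ s}

/-- Law-invariance: the value at `X` depends only on the distribution function of `X`. -/
def ExposureMeasure.IsLawInvariant {Ω : Type*} [MeasurableSpace Ω] {P : Measure Ω}
    {𝒳 : Set (Ω →ₘ[P] ℝ)} (ρ : ExposureMeasure P 𝒳) : Prop :=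
  ∀ X ∈ 𝒳, ∀ Y ∈ 𝒳, distFun X = distFun Y → ρ.toFun X = ρ.toFun Y

open Classical in
/-- A law-invariant exposure measure as a map of distribution functions: `ρ(F) = ρ(X)` for any
`X ∈ 𝒳` with distribution function `F`. On an atomless probability space with `L^∞ ⊆ 𝒳`, such an
`X` exists whenever `F` is the distribution function of a bounded random variable; the default
value `∞` is used only when there is none. -/
noncomputable def ExposureMeasure.ofDistFun {Ω : Type*} [MeasurableSpace Ω] {P : Measure Ω}
    {𝒳 : Set (Ω →ₘ[P] ℝ)} (ρ : ExposureMeasure P 𝒳) (F : ℝ → ℝ) : WithTop ℝ :=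
  if h : ∃ X ∈ 𝒳, distFun X = F then ρ.toFun h.choose else ⊤

/-- The empirical distribution function `s ↦ (1/n) ∑ᵢ 1_{s ≥ xᵢ}` of a sample. -/
noncomputable def empiricalDistFun {n : ℕ} (x : Fin n → ℝ) (s : ℝ) : ℝ :=
  (1 / (n : ℝ)) * ∑ i, if x i ≤ s then (1 : ℝ) else 0

/-- The empirical exposure estimator `ρ̂(x) = ρ(F_x)`. -/
noncomputable def ExposureMeasure.empirical {Ω : Type*} [MeasurableSpace Ω] {P : Measure Ω}
    {𝒳 : Set (Ω →ₘ[P] ℝ)} (ρ : ExposureMeasure P 𝒳) {n : ℕ} (x : Fin n → ℝ) : WithTop ℝ :=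
  ρ.ofDistFun (empiricalDistFun x)

/-- The realized exposures `(f(zᵢ)⁺)ᵢ` of a value function `f` at the scenarios `zᵢ`. -/
def realizedExposures (f : ℝ → ℝ) {n : ℕ} (z : Fin n → ℝ) : Fin n → ℝ :=
  fun i => max (f (z i)) 0

/-- The Chebyshev points `cos(π k / N)`, `k = 0, …, N`, in `[-1, 1]`. -/
noncomputable def chebyshevPoint (N : ℕ) (k : Fin (N + 1)) : ℝ :=
  Real.cos (Real.pi * (k : ℕ) / N)

/-- The affine map `τ : [-1, 1] → [a, b]`, `τ(z) = b + (a - b) / 2 * (1 - z)`. -/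
noncomputable def affineMapTo (a b : ℝ) (z : ℝ) : ℝ :=
  b + (a - b) / 2 * (1 - z)

/-- The complex extension of the affine map `τ`. -/
noncomputable def affineMapToC (a b : ℝ) (z : ℂ) : ℂ :=
  (b : ℂ) + ((a : ℂ) - b) / 2 * (1 - z)

/-- The inverse `τ⁻¹ : [a, b] → [-1, 1]` of the affine map (for `a < b`). -/
noncomputable def affineMapInv (a b : ℝ) (t : ℝ) : ℝ :=
  1 - 2 * (b - t) / (b - a)

/-- The Chebyshev interpolant `I_N(f)` on `[a, b]`: the polynomial of degree at most `N` that
interpolates `f ∘ τ` at the `N + 1` Chebyshev points, transported to `[a, b]` by `τ`. -/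
noncomputable def chebyshevInterpolant (a b : ℝ) (N : ℕ) (f : ℝ → ℝ) (t : ℝ) : ℝ :=
  (Lagrange.interpolate Finset.univ (chebyshevPoint N)
    (fun k => f (affineMapTo a b (chebyshevPoint N k)))).eval (affineMapInv a b t)

/-- The open Bernstein ellipse `ℰ([-1, 1], ϱ)`: foci `±1`, and semi-axes `(ϱ + ϱ⁻¹) / 2` and
`(ϱ - ϱ⁻¹) / 2`, which sum to `ϱ`. Points inside are those whose distances to the two foci sum to
less than the major axis `ϱ + ϱ⁻¹`. -/
def bernsteinEllipse (ϱ : ℝ) : Set ℂ :=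
  {z | ‖z - 1‖ + ‖z + 1‖ < ϱ + ϱ⁻¹}

/-- The generalized Bernstein ellipse `ℰ([a, b], ϱ) = τ(ℰ([-1, 1], ϱ))`. -/
def generalizedBernsteinEllipse (a b ϱ : ℝ) : Set ℂ :=
  affineMapToC a b '' bernsteinEllipse ϱ

/-- `f, f', …, f^{(p-1)}` are absolutely continuous on `[a, b]`, and `f^{(p)}`, which then exists
almost everywhere, agrees almost everywhere with a function of total variation at most `C` on
`[a, b]`. Only the values of `f` on `[a, b]` matter. -/
def HasDerivOfBoundedVariation (a b : ℝ) (f : ℝ → ℝ) (p : ℕ) (C : NNReal) : Prop :=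
  (∀ k < p, AbsolutelyContinuousOnInterval (iteratedDerivWithin k f (Icc a b)) a b) ∧
  ∃ g : ℝ → ℝ, iteratedDerivWithin p f (Icc a b) =ᵐ[volume.restrict (Icc a b)] g ∧
    eVariationOn g (Icc a b) ≤ C

/-!
Chebyshev interpolation is accurate in the maximum norm, and a law-invariant exposure measure
transports that accuracy to the empirical estimator.

*The estimator.* An atomless probability space carries a uniformly distributed label
`L : Ω → Fin n` (Sierpiński's theorem, `IsAtomless.exists_subset_measureReal_eq`). The variables
`x ∘ L` and `y ∘ L` have the empirical distribution functions of the samples `x` and `y`, and they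
differ by at most `max |x i - y i|`. Monotonicity and cash-additivity thus make the estimator
`1`-Lipschitz for the maximum norm (`ExposureMeasure.exists_abs_empirical_sub_le`), and finite by
comparison with `0`. As `max · 0` is `1`-Lipschitz too, the claim reduces to a uniform bound of the
interpolation error on `[a, b]`.

*The interpolation error.* Write `h = V ∘ τ` as the Chebyshev series `∑ a_k T_k`, which is the
Fourier series of `h ∘ cos`. On the Chebyshev points each `T_k` coincides with some `T_m`, `m ≤ N`,
so that interpolation reproduces `T_k` for `k ≤ N` and changes it by at most `2` otherwise. The
error is therefore at most `2 ∑_{k > N} |a_k|` (`abs_sub_interpolate_le`).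

*The coefficients.* In the analytic case, `a_k` is a contour integral of `V (τ ((w + w⁻¹) / 2))`
against `w ^ (-k - 1)`. Moving the unit circle outwards to radius `ϱ` gives `|a_k| ≤ 2 C ϱ ^ (-k)`,
and the tail is a geometric series (`abs_sub_interpolate_le_of_analytic`). In the other case, `p`
integrations by parts reduce to the coefficients of a function of bounded variation, which are
estimated on half periods of the cosine (`abs_integral_mul_cos_le`). This gives
`|a_k| ≤ (2 / π) ((b - a) / 2) ^ p C / (k (k - 1) ⋯ (k - p))`, whose tail telescopes
(`abs_sub_interpolate_le_of_boundedVariation`).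
-/

/-! ### Atomless probability spaces and the empirical estimator -/

section Atomless

variable {Ω : Type*} [MeasurableSpace Ω] {P : Measure Ω}

lemma IsAtomless.exists_subset_measureReal_le_half [IsFiniteMeasure P] (hP : IsAtomless P)
    {A : Set Ω} (hA : MeasurableSet A) (h0 : 0 < P.real A) :
    ∃ B ⊆ A, MeasurableSet B ∧ 0 < P.real B ∧ P.real B ≤ P.real A / 2 := by
  have h0' : 0 < P A := (ENNReal.toReal_pos_iff.1 h0).1
  obtain ⟨B, hBA, hB, hB0, hBlt⟩ := hP A hA h0'
  have hB0' : 0 < P.real B := ENNReal.toReal_pos hB0.ne' (measure_ne_top P B)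
  have hlt : P.real B < P.real A :=
    (ENNReal.toReal_lt_toReal (measure_ne_top P B) (measure_ne_top P A)).2 hBlt
  have hdiff : P.real (A \ B) = P.real A - P.real B := measureReal_sdiff hBA hB
  rcases le_total (P.real B) (P.real A / 2) with h | h
  · exact ⟨B, hBA, hB, hB0', h⟩
  · exact ⟨A \ B, sdiff_subset, hA.diff hB, by linarith, by linarith⟩

lemma IsAtomless.exists_subset_measureReal_lt [IsFiniteMeasure P] (hP : IsAtomless P)
    {A : Set Ω} (hA : MeasurableSet A) (h0 : 0 < P.real A) {ε : ℝ} (hε : 0 < ε) :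
    ∃ B ⊆ A, MeasurableSet B ∧ 0 < P.real B ∧ P.real B < ε := by
  have key : ∀ k : ℕ, ∃ B ⊆ A, MeasurableSet B ∧ 0 < P.real B ∧
      P.real B ≤ P.real A * (1 / 2) ^ k := by
    intro k
    induction k with
    | zero => exact ⟨A, subset_rfl, hA, h0, by simp⟩
    | succ k ih =>
      obtain ⟨B, hBA, hB, hB0, hle⟩ := ih
      obtain ⟨B', hB'B, hB', hB'0, hle'⟩ := hP.exists_subset_measureReal_le_half hB hB0
      exact ⟨B', hB'B.trans hBA, hB', hB'0, by rw [pow_succ]; linarith⟩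
  obtain ⟨k, hk⟩ := exists_pow_lt_of_lt_one (div_pos hε h0) (by norm_num : (1 / 2 : ℝ) < 1)
  obtain ⟨B, hBA, hB, hB0, hle⟩ := key k
  refine ⟨B, hBA, hB, hB0, hle.trans_lt ?_⟩
  rwa [lt_div_iff₀ h0, mul_comm] at hk

/-- Sierpiński's theorem: an atomless finite measure takes all intermediate values. The set is the
union of an increasing sequence in which each term is almost as large as is possible for a set that
contains its predecessor and has measure at most `t`. -/
lemma IsAtomless.exists_subset_measureReal_eq [IsFiniteMeasure P] (hP : IsAtomless P)
    {A : Set Ω} (hA : MeasurableSet A) {t : ℝ} (ht0 : 0 ≤ t) (ht : t ≤ P.real A) :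
    ∃ B ⊆ A, MeasurableSet B ∧ P.real B = t := by
  let S : Type _ := {B : Set Ω // B ⊆ A ∧ MeasurableSet B ∧ P.real B ≤ t}
  have step : ∀ (B : S) (k : ℕ), ∃ B' : S, B.1 ⊆ B'.1 ∧
      ∀ C : S, B.1 ⊆ C.1 → P.real C.1 ≤ P.real B'.1 + 1 / ((k : ℝ) + 1) := by
    intro B k
    let R : Set ℝ := (fun C : S => P.real C.1) '' {C | B.1 ⊆ C.1}
    have hR : BddAbove R := ⟨t, by rintro _ ⟨C, _, rfl⟩; exact C.2.2.2⟩
    have hne : R.Nonempty := ⟨_, B, Subset.refl B.1, rfl⟩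
    obtain ⟨_, ⟨B', hB', rfl⟩, hlt⟩ :=
      exists_lt_of_lt_csSup hne (sub_lt_self (sSup R) (Nat.one_div_pos_of_nat (n := k) (α := ℝ)))
    refine ⟨B', hB', fun C hC => ?_⟩
    have := le_csSup hR ⟨C, hC, rfl⟩
    simp only at hlt this
    linarith
  choose next hsub hbig using step
  let Q : ℕ → S := fun k => Nat.rec ⟨∅, empty_subset _, MeasurableSet.empty, by simpa using ht0⟩
    (fun k B => next B k) k
  have hmono : Monotone fun k => (Q k).1 := monotone_nat_of_le_succ fun k => hsub (Q k) k
  have hmeas : MeasurableSet (⋃ k, (Q k).1) := MeasurableSet.iUnion fun k => (Q k).2.2.1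
  have hsubA : (⋃ k, (Q k).1) ⊆ A := iUnion_subset fun k => (Q k).2.1
  have htend : Filter.Tendsto (fun k => P.real (Q k).1) Filter.atTop
      (nhds (P.real (⋃ k, (Q k).1))) :=
    (ENNReal.tendsto_toReal (measure_ne_top _ _)).comp (tendsto_measure_iUnion_atTop hmono)
  have hle : P.real (⋃ k, (Q k).1) ≤ t := le_of_tendsto' htend fun k => (Q k).2.2.2
  refine ⟨_, hsubA, hmeas, hle.antisymm ?_⟩
  by_contra! hlt
  set U := ⋃ k, (Q k).1 with hU
  have hdiff : P.real (A \ U) = P.real A - P.real U := measureReal_sdiff hsubA hmeas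
  obtain ⟨C, hCA, hC, hC0, hClt⟩ := hP.exists_subset_measureReal_lt (hA.diff hmeas)
    (by linarith) (sub_pos.2 hlt)
  have hunion : P.real (U ∪ C) = P.real U + P.real C :=
    measureReal_union (disjoint_sdiff_right.mono_right hCA) hC
  let D : S := ⟨U ∪ C, union_subset hsubA (hCA.trans sdiff_subset), hmeas.union hC, by linarith⟩
  have hbound : ∀ k : ℕ, P.real C ≤ 1 / ((k : ℝ) + 1) := by
    intro k
    have h1 := hbig (Q k) k D ((subset_iUnion (fun k => (Q k).1) k).trans subset_union_left)
    have h2 : P.real (Q (k + 1)).1 ≤ P.real U :=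
      measureReal_mono (subset_iUnion (fun k => (Q k).1) (k + 1))
    have h3 : P.real D.1 = P.real U + P.real C := hunion
    have h4 : (Q (k + 1)).1 = (next (Q k) k).1 := rfl
    rw [h4] at h2
    linarith
  obtain ⟨k, hk⟩ := exists_nat_one_div_lt hC0
  exact absurd (hbound k) (not_le.2 hk)

/-- A set of measure `(m + 1) * c` splits into `m + 1` parts of measure `c`, encoded as the level
sets of a label. -/
lemma IsAtomless.exists_nat_label [IsFiniteMeasure P] (hP : IsAtomless P) {c : ℝ} (hc : 0 ≤ c)
    (m : ℕ) : ∀ {A : Set Ω}, MeasurableSet A → P.real A = (m + 1) * c →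
      ∃ L : Ω → ℕ, Measurable L ∧ (∀ ω, L ω ≤ m) ∧ ∀ i ≤ m, P.real (A ∩ L ⁻¹' {i}) = c := by
  classical
  induction m with
  | zero =>
    intro A _ hPA
    refine ⟨fun _ => 0, measurable_const, fun _ => le_rfl, fun i hi => ?_⟩
    obtain rfl : i = 0 := by omega
    simpa using hPA
  | succ m ih =>
    intro A hA hPA
    push_cast at hPA
    obtain ⟨B, hBA, hB, hPB⟩ := hP.exists_subset_measureReal_eq hA hc
      (by rw [hPA]; nlinarith [(Nat.cast_nonneg m : (0 : ℝ) ≤ m)])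
    have hdiff : P.real (A \ B) = P.real A - P.real B := measureReal_sdiff hBA hB
    obtain ⟨L, hL, hLm, hLc⟩ := ih (hA.diff hB) (by rw [hdiff, hPA, hPB]; ring)
    refine ⟨B.piecewise (fun _ => m + 1) L, measurable_const.piecewise hB hL, fun ω => ?_,
      fun i hi => ?_⟩
    · by_cases h : ω ∈ B
      · simp [h]
      · simpa [h] using (hLm ω).trans (Nat.le_succ m)
    · rcases Nat.lt_or_ge m i with h | h
      · obtain rfl : i = m + 1 := by omega
        rw [← hPB]
        congr 1
        ext ω
        by_cases hω : ω ∈ B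
        · simp [hω, hBA hω]
        · have := hLm ω
          simp [hω]
          omega
      · rw [← hLc i h]
        congr 1
        ext ω
        by_cases hω : ω ∈ B
        · simp [hω]
          omega
        · simp [hω]

/-- An atomless probability space carries a uniformly distributed random element of `Fin n`. -/
lemma IsAtomless.exists_uniform_label [IsProbabilityMeasure P] (hP : IsAtomless P) {n : ℕ}
    (hn : 1 ≤ n) :
    ∃ L : Ω → Fin n, Measurable L ∧ ∀ i, P.real (L ⁻¹' {i}) = 1 / n := by
  obtain ⟨m, rfl⟩ : ∃ m, n = m + 1 := ⟨n - 1, by omega⟩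
  obtain ⟨L, hL, hLm, hLc⟩ := hP.exists_nat_label (c := 1 / ((m : ℝ) + 1)) (by positivity) m
    MeasurableSet.univ (by rw [probReal_univ]; field_simp)
  have hpre : ∀ i : Fin (m + 1),
      (fun ω => (⟨L ω, Nat.lt_succ_of_le (hLm ω)⟩ : Fin (m + 1))) ⁻¹' {i} = L ⁻¹' {(i : ℕ)} := by
    intro i
    ext ω
    simp [Fin.ext_iff]
  refine ⟨fun ω => ⟨L ω, Nat.lt_succ_of_le (hLm ω)⟩, measurable_to_countable' fun i => ?_,
    fun i => ?_⟩
  · rw [hpre]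
    exact hL (measurableSet_singleton _)
  · rw [hpre]
    have := hLc i (Nat.le_of_lt_succ i.2)
    rw [univ_inter] at this
    rw [this]
    push_cast
    rfl

end Atomless

section Estimator

variable {Ω : Type*} [MeasurableSpace Ω] {P : Measure Ω}

/-- The random variable that takes the value `x i` where the label `L` equals `i`. -/
noncomputable def sampleOfLabel (P : Measure Ω) {n : ℕ} {L : Ω → Fin n} (hL : Measurable L)
    (x : Fin n → ℝ) : Ω →ₘ[P] ℝ :=
  AEEqFun.mk (fun ω => x (L ω)) ((measurable_from_top (f := x)).comp hL).aestronglyMeasurable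

lemma coeFn_sampleOfLabel {n : ℕ} {L : Ω → Fin n} (hL : Measurable L) (x : Fin n → ℝ) :
    sampleOfLabel P hL x =ᵐ[P] fun ω => x (L ω) :=
  AEEqFun.coeFn_mk _ _

lemma sampleOfLabel_mem_Lp_top [IsFiniteMeasure P] {n : ℕ} {L : Ω → Fin n} (hL : Measurable L)
    (x : Fin n → ℝ) : sampleOfLabel P hL x ∈ Lp ℝ ⊤ P := by
  refine Lp.mem_Lp_of_ae_bound (∑ i, |x i|) ?_
  filter_upwards [coeFn_sampleOfLabel (P := P) hL x] with ω hω
  rw [hω, Real.norm_eq_abs]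
  exact Finset.single_le_sum (f := fun i => |x i|) (fun i _ => abs_nonneg _) (Finset.mem_univ _)

lemma sampleOfLabel_mono {n : ℕ} {L : Ω → Fin n} (hL : Measurable L) {x y : Fin n → ℝ}
    (h : ∀ i, x i ≤ y i) : sampleOfLabel P hL x ≤ sampleOfLabel P hL y :=
  (AEEqFun.mk_le_mk _ _).2 (Filter.Eventually.of_forall fun ω => h (L ω))

lemma sampleOfLabel_add_const {n : ℕ} {L : Ω → Fin n} (hL : Measurable L) (x : Fin n → ℝ)
    (c : ℝ) :
    sampleOfLabel P hL x + AEEqFun.const Ω c = sampleOfLabel P hL fun i => x i + c := by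
  rw [sampleOfLabel, AEEqFun.const, AEEqFun.mk_add_mk]
  rfl

lemma distFun_sampleOfLabel [IsFiniteMeasure P] {n : ℕ} {L : Ω → Fin n} (hL : Measurable L)
    (hu : ∀ i, P.real (L ⁻¹' {i}) = 1 / n) (x : Fin n → ℝ) :
    distFun (sampleOfLabel P hL x) = empiricalDistFun x := by
  funext s
  have h1 : distFun (sampleOfLabel P hL x) s = P.real {ω | x (L ω) ≤ s} := by
    refine measureReal_congr ?_
    filter_upwards [coeFn_sampleOfLabel (P := P) hL x] with ω hω
    simp only [eq_iff_iff]
    change (sampleOfLabel P hL x ω ≤ s) ↔ (x (L ω) ≤ s)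
    rw [hω]
  have h2 : {ω | x (L ω) ≤ s} = ⋃ i ∈ Finset.univ.filter (fun i => x i ≤ s), L ⁻¹' {i} := by
    ext ω
    simp
  rw [h1, h2, measureReal_biUnion_finset, empiricalDistFun, Finset.mul_sum, Finset.sum_filter]
  · refine Finset.sum_congr rfl fun i _ => ?_
    split_ifs <;> simp [hu i]
  · intro i _ j _ hij
    exact Disjoint.preimage L (by simpa using hij)
  · exact fun i _ => hL (measurableSet_singleton i)

variable {𝒳 : Set (Ω →ₘ[P] ℝ)}

lemma ExposureMeasure.empirical_eq_toFun [IsFiniteMeasure P] {ρ : ExposureMeasure P 𝒳}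
    (hρ : ρ.IsLawInvariant) (h𝒳 : (Lp ℝ ⊤ P : Set (Ω →ₘ[P] ℝ)) ⊆ 𝒳) {n : ℕ} {L : Ω → Fin n}
    (hL : Measurable L) (hu : ∀ i, P.real (L ⁻¹' {i}) = 1 / n) (x : Fin n → ℝ) :
    ρ.empirical x = ρ.toFun (sampleOfLabel P hL x) := by
  have hmem := h𝒳 (sampleOfLabel_mem_Lp_top (P := P) hL x)
  have hex : ∃ X ∈ 𝒳, distFun X = empiricalDistFun x := ⟨_, hmem, distFun_sampleOfLabel hL hu x⟩
  rw [empirical, ofDistFun, dif_pos hex]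
  exact hρ _ hex.choose_spec.1 _ hmem
    (hex.choose_spec.2.trans (distFun_sampleOfLabel hL hu x).symm)

/-- The empirical estimator of a law-invariant exposure measure is finite, and it is
`1`-Lipschitz for the maximum norm: both samples are realized by one uniform label, and
`X ≤ Y + ε` almost surely gives `ρ(X) ≤ ρ(Y) + ε`. -/
theorem ExposureMeasure.exists_abs_empirical_sub_le [IsProbabilityMeasure P] (hP : IsAtomless P)
    (h𝒳 : (Lp ℝ ⊤ P : Set (Ω →ₘ[P] ℝ)) ⊆ 𝒳) {ρ : ExposureMeasure P 𝒳} (hρ : ρ.IsLawInvariant)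
    (hρ0 : ρ.toFun 0 ≠ ⊤) {n : ℕ} (hn : 1 ≤ n) {x y : Fin n → ℝ} {ε : ℝ}
    (h : ∀ i, |x i - y i| ≤ ε) :
    ∃ r s : ℝ, ρ.empirical x = (r : WithTop ℝ) ∧ ρ.empirical y = (s : WithTop ℝ) ∧
      |r - s| ≤ ε := by
  obtain ⟨L, hL, hu⟩ := hP.exists_uniform_label hn
  have hmem : ∀ w, sampleOfLabel P hL w ∈ 𝒳 := fun w => h𝒳 (sampleOfLabel_mem_Lp_top hL w)
  have hle : ∀ (v w : Fin n → ℝ) (c : ℝ), (∀ i, v i ≤ w i + c) →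
      ρ.toFun (sampleOfLabel P hL v) ≤ ρ.toFun (sampleOfLabel P hL w) + (c : WithTop ℝ) := by
    intro v w c hvw
    have h1 := ρ.cash_additive _ (hmem w) c (by rw [sampleOfLabel_add_const]; exact hmem _)
    rw [← h1, sampleOfLabel_add_const]
    exact ρ.monotone _ (hmem _) _ (hmem _) (sampleOfLabel_mono hL hvw)
  have hzero : sampleOfLabel P hL (fun _ => 0) = 0 := rfl
  have hfin : ∀ w, ∃ r : ℝ, ρ.toFun (sampleOfLabel P hL w) = (r : WithTop ℝ) := by
    intro w
    have h1 := hle w (fun _ => 0) (∑ i, |w i|) fun i => by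
      rw [zero_add]
      exact (le_abs_self _).trans
        (Finset.single_le_sum (f := fun i => |w i|) (fun i _ => abs_nonneg _) (Finset.mem_univ i))
    rw [hzero] at h1
    have h2 : ρ.toFun (sampleOfLabel P hL w) ≠ ⊤ :=
      (h1.trans_lt (WithTop.add_lt_top.2 ⟨lt_top_iff_ne_top.2 hρ0, WithTop.coe_lt_top _⟩)).ne
    obtain ⟨r, hr⟩ := WithTop.ne_top_iff_exists.1 h2
    exact ⟨r, hr.symm⟩
  obtain ⟨r, hr⟩ := hfin x
  obtain ⟨s, hs⟩ := hfin y
  refine ⟨r, s, (empirical_eq_toFun hρ h𝒳 hL hu x).trans hr,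
    (empirical_eq_toFun hρ h𝒳 hL hu y).trans hs, ?_⟩
  have h1 := hle x y ε fun i => by linarith [(abs_le.1 (h i)).2]
  have h2 := hle y x ε fun i => by linarith [(abs_le.1 (h i)).1]
  rw [hr, hs, ← WithTop.coe_add, WithTop.coe_le_coe] at h1 h2
  exact abs_le.2 ⟨by linarith, by linarith⟩

end Estimator

/-! ### Chebyshev interpolation and the cosine coefficients -/

section Interpolation

open Polynomial

lemma chebyshevPoint_mem_Icc (N : ℕ) (k : Fin (N + 1)) : chebyshevPoint N k ∈ Icc (-1 : ℝ) 1 :=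
  Real.cos_mem_Icc _

lemma chebyshevPoint_injective {N : ℕ} (hN : 1 ≤ N) : Function.Injective (chebyshevPoint N) := by
  have hN' : (0 : ℝ) < N := by exact_mod_cast hN
  have hmem : ∀ k : Fin (N + 1), Real.pi * (k : ℕ) / N ∈ Icc 0 Real.pi := by
    intro k
    have hk : ((k : ℕ) : ℝ) ≤ N := by exact_mod_cast Nat.le_of_lt_succ k.2
    refine ⟨by positivity, ?_⟩
    rw [div_le_iff₀ hN']
    exact mul_le_mul_of_nonneg_left hk Real.pi_pos.le
  intro i j hij
  have h := Real.injOn_cos (hmem i) (hmem j) hij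
  rw [div_left_inj' hN'.ne', mul_right_inj' Real.pi_ne_zero] at h
  exact Fin.ext (by exact_mod_cast h)

/-- Aliasing: on the Chebyshev points, every Chebyshev polynomial coincides with one of degree at
most `N`. -/
lemma exists_chebyshev_T_eq_on_chebyshevPoint {N : ℕ} (hN : 1 ≤ N) (k : ℕ) :
    ∃ m : ℕ, m ≤ N ∧ ∀ j : Fin (N + 1),
      (Chebyshev.T ℝ k).eval (chebyshevPoint N j) =
        (Chebyshev.T ℝ m).eval (chebyshevPoint N j) := by
  have hN' : (N : ℝ) ≠ 0 := by exact_mod_cast (by omega : N ≠ 0)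
  have hk : (k : ℝ) = 2 * N * (k / (2 * N) : ℕ) + (k % (2 * N) : ℕ) := by
    exact_mod_cast (Nat.div_add_mod k (2 * N)).symm
  have hlt : k % (2 * N) < 2 * N := Nat.mod_lt _ (by omega)
  set q := k / (2 * N)
  set r := k % (2 * N)
  have hcos : ∀ j : Fin (N + 1), Real.cos ((k : ℝ) * (Real.pi * (j : ℕ) / N)) =
      Real.cos ((r : ℝ) * (Real.pi * (j : ℕ) / N)) := by
    intro j
    rw [← Real.cos_add_nat_mul_two_pi ((r : ℝ) * (Real.pi * (j : ℕ) / N)) (q * j)]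
    congr 1
    rw [hk]
    push_cast
    field_simp
    ring
  rcases le_total r N with h | h
  · refine ⟨r, h, fun j => ?_⟩
    simp only [chebyshevPoint, Chebyshev.T_real_cos, Int.cast_natCast]
    exact hcos j
  · refine ⟨2 * N - r, by omega, fun j => ?_⟩
    simp only [chebyshevPoint, Chebyshev.T_real_cos, Int.cast_natCast]
    rw [hcos j, Nat.cast_sub hlt.le, ← Real.cos_nat_mul_two_pi_sub _ j]
    congr 1
    push_cast
    field_simp

/-- The error of Chebyshev interpolation of `T_k` at the point `x`. -/
noncomputable def chebyshevAliasError (N k : ℕ) (x : ℝ) : ℝ :=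
  (Chebyshev.T ℝ k).eval x - (Lagrange.interpolate Finset.univ (chebyshevPoint N)
    (fun j => (Chebyshev.T ℝ k).eval (chebyshevPoint N j))).eval x

lemma interpolate_chebyshev_T {N m : ℕ} (hN : 1 ≤ N) (hm : m ≤ N) :
    Lagrange.interpolate Finset.univ (chebyshevPoint N)
      (fun j => (Chebyshev.T ℝ m).eval (chebyshevPoint N j)) = Chebyshev.T ℝ m := by
  refine (Lagrange.eq_interpolate (chebyshevPoint_injective hN).injOn ?_).symm
  rw [Chebyshev.degree_T]
  simp only [Int.natAbs_natCast, Finset.card_univ, Fintype.card_fin]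
  exact_mod_cast Nat.lt_succ_of_le hm

lemma chebyshevAliasError_eq_zero {N k : ℕ} (hN : 1 ≤ N) (hk : k ≤ N) (x : ℝ) :
    chebyshevAliasError N k x = 0 := by
  rw [chebyshevAliasError, interpolate_chebyshev_T hN hk, sub_self]

lemma abs_chebyshevAliasError_le {N : ℕ} (hN : 1 ≤ N) (k : ℕ) {x : ℝ} (hx : x ∈ Icc (-1 : ℝ) 1) :
    |chebyshevAliasError N k x| ≤ 2 := by
  obtain ⟨m, hm, h⟩ := exists_chebyshev_T_eq_on_chebyshevPoint hN k
  rw [chebyshevAliasError, funext h, interpolate_chebyshev_T hN hm]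
  have h1 := Chebyshev.abs_eval_T_real_le_one k (abs_le.2 hx)
  have h2 := Chebyshev.abs_eval_T_real_le_one m (abs_le.2 hx)
  exact (abs_sub _ _).trans (by linarith)

end Interpolation

section CosineSeries

open Real

/-- The unnormalized cosine coefficient of `h ∘ cos`; up to the factor `2 / π` it is the
`k`-th Chebyshev coefficient of `h`. The integral runs over `[-π, 0]`, where `cos` is
monotone increasing. -/
noncomputable def cosCoeff (h : ℝ → ℝ) (k : ℕ) : ℝ :=
  ∫ θ in (-π)..0, h (cos θ) * cos (k * θ)

lemma continuous_comp_cos {h : ℝ → ℝ} (hc : ContinuousOn h (Icc (-1) 1)) :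
    Continuous fun θ => h (cos θ) :=
  hc.comp_continuous continuous_cos cos_mem_Icc

lemma integral_exp_mul_comp_cos {h : ℝ → ℝ} (hc : ContinuousOn h (Icc (-1) 1)) (n : ℤ) :
    ∫ θ in (-π)..π, Complex.exp (n * θ * Complex.I) * (h (cos θ) : ℂ) =
      2 * (cosCoeff h n.natAbs : ℂ) := by
  have hcont : Continuous fun θ : ℝ => (h (cos θ) : ℂ) :=
    Complex.continuous_ofReal.comp (continuous_comp_cos hc)
  have hF : Continuous fun θ : ℝ => Complex.exp (n * θ * Complex.I) * (h (cos θ) : ℂ) := by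
    fun_prop
  have hG : Continuous fun θ : ℝ => Complex.exp (n * (-θ : ℝ) * Complex.I) * (h (cos θ) : ℂ) := by
    fun_prop
  have hneg : ∫ θ in (0 : ℝ)..π, Complex.exp (n * θ * Complex.I) * (h (cos θ) : ℂ) =
      ∫ θ in (-π)..0, Complex.exp (n * (-θ : ℝ) * Complex.I) * (h (cos θ) : ℂ) := by
    have := intervalIntegral.integral_comp_neg (a := -π) (b := 0)
      (fun θ : ℝ => Complex.exp (n * θ * Complex.I) * (h (cos θ) : ℂ))
    rw [neg_zero, neg_neg] at this
    rw [← this]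
    simp only [cos_neg]
  rw [← intervalIntegral.integral_add_adjacent_intervals (hF.intervalIntegrable (-π) 0)
    (hF.intervalIntegrable 0 π), hneg, ← intervalIntegral.integral_add
    (hF.intervalIntegrable _ _) (hG.intervalIntegrable _ _), cosCoeff,
    ← intervalIntegral.integral_ofReal, ← intervalIntegral.integral_const_mul]
  refine intervalIntegral.integral_congr fun θ _ => ?_
  have hcos : cos ((n.natAbs : ℝ) * θ) = cos (n * θ) := by
    rw [Nat.cast_natAbs, Int.cast_abs]
    rcases abs_choice (n : ℝ) with h | h <;> simp [h]
  rw [hcos, ← add_mul]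
  push_cast
  rw [Complex.cos]
  ring_nf

/-- The cosine series of `h ∘ cos`. The term `k = 0` is counted twice, which the constant
`cosCoeff h 0 / π` on the right balances. -/
lemma hasSum_cosCoeff {h : ℝ → ℝ} (hc : ContinuousOn h (Icc (-1) 1))
    (hs : Summable (cosCoeff h)) (θ : ℝ) :
    HasSum (fun k : ℕ => 2 / π * cosCoeff h k * cos (k * θ)) (h (cos θ) + cosCoeff h 0 / π) := by
  have hT : Fact (0 < 2 * π) := ⟨two_pi_pos⟩
  have hcont : Continuous fun θ : ℝ => (h (cos θ) : ℂ) :=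
    Complex.continuous_ofReal.comp (continuous_comp_cos hc)
  have hper : Function.Periodic (fun θ : ℝ => (h (cos θ) : ℂ)) (2 * π) := fun θ => by simp
  let f : C(AddCircle (2 * π), ℂ) := ⟨hper.lift, continuous_coinduced_dom.2 hcont⟩
  have hf : ∀ θ : ℝ, f (θ : AddCircle (2 * π)) = (h (cos θ) : ℂ) := fun θ => rfl
  have hfourier : ∀ (n : ℤ) (θ : ℝ), fourier n (θ : AddCircle (2 * π)) =
      Complex.exp (n * θ * Complex.I) := by
    intro n θ
    rw [fourier_coe_apply]
    congr 1
    push_cast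
    have : (π : ℂ) ≠ 0 := by exact_mod_cast pi_ne_zero
    field_simp
  have hcoef : ∀ n : ℤ, fourierCoeff f n = ((cosCoeff h n.natAbs / π : ℝ) : ℂ) := by
    intro n
    rw [fourierCoeff_eq_intervalIntegral f n (-π), show -π + 2 * π = π by ring]
    simp only [hfourier, hf, smul_eq_mul]
    rw [integral_exp_mul_comp_cos hc, Int.natAbs_neg, Complex.real_smul]
    push_cast
    have : (π : ℂ) ≠ 0 := by exact_mod_cast pi_ne_zero
    field_simp
  have hsum : Summable (fourierCoeff f) := by
    have h1 : Summable fun k : ℕ => ((cosCoeff h k / π : ℝ) : ℂ) :=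
      Complex.summable_ofReal.2 (hs.div_const π)
    refine Summable.of_nat_of_neg ?_ ?_ <;> simpa only [hcoef, Int.natAbs_neg, Int.natAbs_natCast]
  have h2 := (has_pointwise_sum_fourier_series_of_summable hsum
    (θ : AddCircle (2 * π))).nat_add_neg
  rw [hf, hcoef] at h2
  have h3 := Complex.hasSum_re h2
  convert h3 using 1
  · funext k
    simp only [hcoef, hfourier, Int.natAbs_neg, Int.natAbs_natCast, smul_eq_mul, Complex.add_re,
      Complex.re_ofReal_mul, Int.cast_natCast, Int.cast_neg]
    have e1 : (Complex.exp ((k : ℂ) * θ * Complex.I)).re = cos (k * θ) := by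
      have := Complex.exp_ofReal_mul_I_re (k * θ)
      push_cast at this
      exact this
    have e2 : (Complex.exp (-(k : ℂ) * θ * Complex.I)).re = cos (k * θ) := by
      have := Complex.exp_ofReal_mul_I_re (-(k * θ))
      push_cast at this
      rw [cos_neg, ← neg_mul] at this
      exact this
    rw [e1, e2]
    ring
  · simp [hfourier]

/-- The interpolation error is controlled by the tail of the Chebyshev coefficients: the
interpolation operator is linear, and it reproduces `T_k` for `k ≤ N` and moves it by at most `2`
for `k > N`. -/
theorem abs_sub_interpolate_le {h : ℝ → ℝ} (hc : ContinuousOn h (Icc (-1) 1)) {N : ℕ}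
    (hN : 1 ≤ N) {u : ℕ → ℝ} (hu : ∀ k, N < k → |cosCoeff h k| ≤ u k) {S : ℝ}
    (hS : HasSum (fun j => u (N + 1 + j)) S) {x : ℝ} (hx : x ∈ Icc (-1 : ℝ) 1) :
    |h x - (Lagrange.interpolate Finset.univ (chebyshevPoint N)
      (fun k => h (chebyshevPoint N k))).eval x| ≤ 4 / π * S := by
  have hs : Summable (cosCoeff h) := by
    rw [← summable_nat_add_iff (N + 1)]
    refine Summable.of_norm_bounded hS.summable fun j => ?_
    rw [add_comm j, Real.norm_eq_abs]
    exact hu _ (by omega)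
  set a : ℕ → ℝ := fun k => 2 / π * cosCoeff h k with ha
  set d := cosCoeff h 0 / π
  have hT : ∀ y ∈ Icc (-1 : ℝ) 1,
      HasSum (fun k : ℕ => a k * (Polynomial.Chebyshev.T ℝ k).eval y) (h y + d) := by
    intro y hy
    have h1 := hasSum_cosCoeff hc hs (arccos y)
    rw [cos_arccos hy.1 hy.2] at h1
    convert h1 using 2 with k
    rw [← cos_arccos hy.1 hy.2, Polynomial.Chebyshev.T_real_cos, cos_arccos hy.1 hy.2]
    simp [ha]
  set B : Fin (N + 1) → ℝ :=
    fun j => (Lagrange.basis Finset.univ (chebyshevPoint N) j).eval x with hB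
  -- The constant `d` cancels from the error because constants are interpolated exactly.
  have hint : ∀ r : Fin (N + 1) → ℝ,
      (Lagrange.interpolate Finset.univ (chebyshevPoint N) r).eval x = ∑ j, r j * B j := by
    intro r
    simp [Lagrange.interpolate_apply, Polynomial.eval_finsetSum, hB]
  have hBsum : ∑ j, B j = 1 := by
    have h1 := congrArg (Polynomial.eval x)
      (Lagrange.sum_basis (chebyshevPoint_injective hN).injOn Finset.univ_nonempty)
    simpa [Polynomial.eval_finsetSum, hB] using h1
  have hsumI : HasSum (fun k : ℕ => ∑ j, a k * (Polynomial.Chebyshev.T ℝ k).eval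
      (chebyshevPoint N j) * B j) (∑ j, (h (chebyshevPoint N j) + d) * B j) :=
    hasSum_sum fun j _ => (hT _ (chebyshevPoint_mem_Icc N j)).mul_right (B j)
  have herr := (hT x hx).sub hsumI
  have hterm : ∀ k : ℕ, a k * (Polynomial.Chebyshev.T ℝ k).eval x -
      ∑ j, a k * (Polynomial.Chebyshev.T ℝ k).eval (chebyshevPoint N j) * B j =
      a k * chebyshevAliasError N k x := by
    intro k
    rw [chebyshevAliasError, hint, mul_sub, Finset.mul_sum]
    simp only [mul_assoc]
  have hval : h x + d - ∑ j, (h (chebyshevPoint N j) + d) * B j =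
      h x - (Lagrange.interpolate Finset.univ (chebyshevPoint N)
        (fun k => h (chebyshevPoint N k))).eval x := by
    simp only [hint, add_mul, Finset.sum_add_distrib, ← Finset.mul_sum, hBsum]
    ring
  simp only [hterm, hval] at herr
  rw [← hasSum_nat_add_iff' (N + 1), Finset.sum_eq_zero, sub_zero] at herr
  · rw [← Real.norm_eq_abs, ← herr.tsum_eq]
    refine tsum_of_norm_bounded (hS.mul_left (4 / π)) fun j => ?_
    have h1 := hu (N + 1 + j) (by omega)
    have h2 := abs_chebyshevAliasError_le hN (j + (N + 1)) hx
    rw [norm_mul, Real.norm_eq_abs, Real.norm_eq_abs, ha]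
    simp only [abs_mul, abs_of_pos (div_pos two_pos pi_pos)]
    rw [add_comm j] at h2 ⊢
    have h0 : 0 ≤ u (N + 1 + j) := (abs_nonneg _).trans h1
    have h3 : 0 ≤ 2 / π * u (N + 1 + j) := by positivity
    calc 2 / π * |cosCoeff h (N + 1 + j)| * |chebyshevAliasError N (N + 1 + j) x|
        ≤ 2 / π * u (N + 1 + j) * 2 := by gcongr
      _ = 4 / π * u (N + 1 + j) := by ring
  · intro k hk
    rw [chebyshevAliasError_eq_zero hN (by simpa [Nat.lt_succ_iff] using hk), mul_zero]

end CosineSeries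

/-! ### Analytic functions on Bernstein ellipses -/

section Analytic

/-- The Joukowsky map sends the annulus `1 ≤ ‖w‖ < ϱ` into the Bernstein ellipse: by the
parallelogram law the distances to the foci sum to `‖w‖ + ‖w‖⁻¹`. -/
lemma joukowsky_mem_bernsteinEllipse {ϱ : ℝ} {w : ℂ} (h1 : 1 ≤ ‖w‖) (h2 : ‖w‖ < ϱ) :
    (w + w⁻¹) / 2 ∈ bernsteinEllipse ϱ := by
  have hpos : 0 < ‖w‖ := by linarith
  have hw : w ≠ 0 := norm_pos_iff.1 hpos
  have e1 : (w + w⁻¹) / 2 - 1 = (w - 1) ^ 2 / (2 * w) := by field_simp; ring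
  have e2 : (w + w⁻¹) / 2 + 1 = (w + 1) ^ 2 / (2 * w) := by field_simp; ring
  have hpar := parallelogram_law_with_norm ℝ w 1
  rw [norm_one] at hpar
  have hsum : ‖(w + w⁻¹) / 2 - 1‖ + ‖(w + w⁻¹) / 2 + 1‖ = ‖w‖ + ‖w‖⁻¹ := by
    rw [e1, e2]
    simp only [norm_div, norm_pow, norm_mul, Complex.norm_ofNat]
    field_simp
    linarith
  rw [bernsteinEllipse, mem_ofPred_eq, hsum]
  have hϱ : 0 < ϱ := hpos.trans h2
  have : ϱ + ϱ⁻¹ - (‖w‖ + ‖w‖⁻¹) = (ϱ - ‖w‖) * (ϱ * ‖w‖ - 1) / (ϱ * ‖w‖) := by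
    field_simp
    ring
  have h3 : 0 < (ϱ - ‖w‖) * (ϱ * ‖w‖ - 1) / (ϱ * ‖w‖) := by
    have h4 : 0 < ϱ - ‖w‖ := by linarith
    have h5 : 0 < ϱ * ‖w‖ - 1 := by nlinarith
    positivity
  linarith

lemma ofReal_mem_bernsteinEllipse {ϱ : ℝ} (hϱ : 1 < ϱ) {x : ℝ} (hx : x ∈ Icc (-1 : ℝ) 1) :
    (x : ℂ) ∈ bernsteinEllipse ϱ := by
  have hw : ‖Complex.exp (Real.arccos x * Complex.I)‖ = 1 := Complex.norm_exp_ofReal_mul_I _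
  have := joukowsky_mem_bernsteinEllipse (ϱ := ϱ) hw.ge (hw.trans_lt hϱ)
  convert this
  rw [← Complex.exp_neg, ← neg_mul, ← Complex.cos, ← Complex.ofReal_cos, Real.cos_arccos hx.1 hx.2]

/-- Up to a constant factor, the coefficient is the integral of `w⁻¹ * w⁻ᵏ * F ((w + w⁻¹) / 2)` over
the unit circle, which may be moved to any circle of radius `s < ϱ`. -/
lemma abs_cosCoeff_le_of_lt {ϱ C : ℝ} {F : ℂ → ℂ} {h : ℝ → ℝ}
    (hd : ∀ w ∈ bernsteinEllipse ϱ, DifferentiableAt ℂ F w)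
    (hF : ∀ x ∈ Icc (-1 : ℝ) 1, F x = h x) (hC : ∀ w ∈ bernsteinEllipse ϱ, ‖F w‖ ≤ C)
    (hc : ContinuousOn h (Icc (-1) 1)) (k : ℕ) {s : ℝ} (hs1 : 1 < s) (hs2 : s < ϱ) :
    |cosCoeff h k| ≤ Real.pi * (C * s⁻¹ ^ k) := by
  have hs0 : 0 < s := by linarith
  let G : ℂ → ℂ := fun w => w⁻¹ ^ k * F ((w + w⁻¹) / 2)
  have hGd : ∀ w : ℂ, 1 ≤ ‖w‖ → ‖w‖ ≤ s → DifferentiableAt ℂ G w := by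
    intro w h1 h2
    have hw : w ≠ 0 := norm_pos_iff.1 (by linarith)
    have h3 := hd _ (joukowsky_mem_bernsteinEllipse h1 (h2.trans_lt hs2))
    have h4 : DifferentiableAt ℂ (fun w : ℂ => (w + w⁻¹) / 2) w :=
      (differentiableAt_id.add (differentiableAt_inv hw)).div_const 2
    exact ((differentiableAt_inv hw).pow k).mul (DifferentiableAt.comp w h3 h4)
  have hshift : (∮ w in C(0, s), (w - 0)⁻¹ • G w) = ∮ w in C(0, 1), (w - 0)⁻¹ • G w := by
    refine Complex.circleIntegral_sub_center_inv_smul_eq_of_differentiable_on_annulus_off_countable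
      one_pos hs1.le countable_empty (fun w hw => ?_) fun w hw => ?_
    · refine (hGd w ?_ ?_).continuousAt.continuousWithinAt
      · simpa using hw.2
      · simpa using hw.1
    · refine hGd w ?_ ?_
      · have := hw.1.2
        simp only [Metric.mem_closedBall, dist_zero_right, not_le] at this
        exact this.le
      · have := hw.1.1
        simp only [Metric.mem_ball, dist_zero_right] at this
        exact this.le
  have hunit : (∮ w in C(0, 1), (w - 0)⁻¹ • G w) = Complex.I * (2 * (cosCoeff h k : ℂ)) := by
    have hint : ∀ θ : ℝ, deriv (circleMap 0 1) θ • ((circleMap 0 1 θ - 0)⁻¹ • G (circleMap 0 1 θ)) =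
        Complex.I * (Complex.exp (((-k : ℤ) : ℂ) * θ * Complex.I) * (h (Real.cos θ) : ℂ)) := by
      intro θ
      have hmap : circleMap 0 1 θ = Complex.exp (θ * Complex.I) := by simp [circleMap]
      have hcos : (Complex.exp (θ * Complex.I) + (Complex.exp (θ * Complex.I))⁻¹) / 2 =
          ((Real.cos θ : ℝ) : ℂ) := by
        rw [← Complex.exp_neg, ← neg_mul, ← Complex.cos, Complex.ofReal_cos]
      have hpow : (Complex.exp (θ * Complex.I))⁻¹ ^ k =
          Complex.exp (((-k : ℤ) : ℂ) * θ * Complex.I) := by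
        rw [← Complex.exp_neg, ← Complex.exp_nat_mul]
        congr 1
        push_cast
        ring
      simp only [deriv_circleMap, smul_eq_mul, sub_zero, G, hmap]
      rw [hcos, hpow, hF _ (Real.cos_mem_Icc θ)]
      have := Complex.exp_ne_zero (θ * Complex.I)
      field_simp
    rw [circleIntegral]
    simp only [hint]
    rw [intervalIntegral.integral_const_mul]
    congr 1
    have hper : Function.Periodic (fun θ : ℝ => Complex.exp (((-k : ℤ) : ℂ) * θ * Complex.I) *
        (h (Real.cos θ) : ℂ)) (2 * Real.pi) := by
      intro θ
      simp only [Real.cos_add_two_pi]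
      congr 1
      rw [Complex.exp_eq_exp_iff_exists_int]
      exact ⟨-k, by push_cast; ring⟩
    have h1 := hper.intervalIntegral_add_eq 0 (-Real.pi)
    rw [zero_add, show -Real.pi + 2 * Real.pi = Real.pi by ring] at h1
    rw [h1, integral_exp_mul_comp_cos hc, Int.natAbs_neg, Int.natAbs_natCast]
  have hbound : ‖∮ w in C(0, s), (w - 0)⁻¹ • G w‖ ≤ 2 * Real.pi * s * (s⁻¹ * (s⁻¹ ^ k * C)) := by
    refine circleIntegral.norm_integral_le_of_norm_le_const hs0.le fun w hw => ?_
    have hws : ‖w‖ = s := by simpa using hw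
    have h1 := hC _ (joukowsky_mem_bernsteinEllipse (w := w) (by linarith) (hws.trans_lt hs2))
    rw [sub_zero, norm_smul, norm_inv, norm_mul, norm_pow, norm_inv, hws]
    gcongr
  rw [hshift, hunit, norm_mul, Complex.norm_I, one_mul, norm_mul, Complex.norm_real,
    Complex.norm_ofNat, Real.norm_eq_abs] at hbound
  have : 2 * Real.pi * s * (s⁻¹ * (s⁻¹ ^ k * C)) = 2 * (Real.pi * (C * s⁻¹ ^ k)) := by
    field_simp
  linarith

lemma abs_cosCoeff_le_of_analytic {ϱ C : ℝ} {F : ℂ → ℂ} {h : ℝ → ℝ} (hϱ : 1 < ϱ)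
    (hd : ∀ w ∈ bernsteinEllipse ϱ, DifferentiableAt ℂ F w)
    (hF : ∀ x ∈ Icc (-1 : ℝ) 1, F x = h x) (hC : ∀ w ∈ bernsteinEllipse ϱ, ‖F w‖ ≤ C)
    (hc : ContinuousOn h (Icc (-1) 1)) (k : ℕ) :
    |cosCoeff h k| ≤ Real.pi * (C * ϱ⁻¹ ^ k) := by
  have hlim : Filter.Tendsto (fun s : ℝ => Real.pi * (C * s⁻¹ ^ k)) (nhdsWithin ϱ (Iio ϱ))
      (nhds (Real.pi * (C * ϱ⁻¹ ^ k))) := by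
    have h1 : ContinuousAt (fun s : ℝ => Real.pi * (C * s⁻¹ ^ k)) ϱ := by
      have := continuousAt_inv₀ (show ϱ ≠ 0 by linarith)
      fun_prop
    exact h1.tendsto.mono_left nhdsWithin_le_nhds
  refine ge_of_tendsto hlim ?_
  filter_upwards [Ioo_mem_nhdsLT hϱ] with s hs
  exact abs_cosCoeff_le_of_lt hd hF hC hc k hs.1 hs.2

lemma continuousOn_of_analytic {ϱ : ℝ} {F : ℂ → ℂ} {h : ℝ → ℝ} (hϱ : 1 < ϱ)
    (hd : ∀ w ∈ bernsteinEllipse ϱ, DifferentiableAt ℂ F w)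
    (hF : ∀ x ∈ Icc (-1 : ℝ) 1, F x = h x) : ContinuousOn h (Icc (-1) 1) := by
  have h1 : ContinuousOn (fun x : ℝ => (F x).re) (Icc (-1) 1) := fun x hx =>
    (Complex.continuous_re.continuousAt.comp
      ((hd _ (ofReal_mem_bernsteinEllipse hϱ hx)).continuousAt.comp
        Complex.continuous_ofReal.continuousAt)).continuousWithinAt
  exact h1.congr fun x hx => by simp [hF x hx]

/-- Chebyshev interpolation of a bounded analytic function on a Bernstein ellipse. -/
theorem abs_sub_interpolate_le_of_analytic {ϱ C : ℝ} {F : ℂ → ℂ} {h : ℝ → ℝ} (hϱ : 1 < ϱ)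
    (hd : ∀ w ∈ bernsteinEllipse ϱ, DifferentiableAt ℂ F w)
    (hF : ∀ x ∈ Icc (-1 : ℝ) 1, F x = h x) (hC : ∀ w ∈ bernsteinEllipse ϱ, ‖F w‖ ≤ C) {N : ℕ}
    (hN : 1 ≤ N) {x : ℝ} (hx : x ∈ Icc (-1 : ℝ) 1) :
    |h x - (Lagrange.interpolate Finset.univ (chebyshevPoint N)
      (fun k => h (chebyshevPoint N k))).eval x| ≤ 4 * C * (ϱ⁻¹ ^ N / (ϱ - 1)) := by
  have hc := continuousOn_of_analytic hϱ hd hF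
  have hgeom := (hasSum_geometric_of_lt_one (inv_nonneg.2 (by linarith : 0 ≤ ϱ))
    (inv_lt_one_of_one_lt₀ hϱ)).mul_left (Real.pi * (C * ϱ⁻¹ ^ (N + 1)))
  have h1 := abs_sub_interpolate_le hc hN
    (fun k _ => abs_cosCoeff_le_of_analytic hϱ hd hF hC hc k)
    (S := Real.pi * (C * ϱ⁻¹ ^ (N + 1)) * (1 - ϱ⁻¹)⁻¹)
    (by simpa only [pow_add, mul_assoc] using hgeom) hx
  refine h1.trans_eq ?_
  have h2 : ϱ - 1 ≠ 0 := by linarith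
  have h3 : ϱ ≠ 0 := by linarith
  have h4 : (1 - ϱ⁻¹)⁻¹ = ϱ / (ϱ - 1) := by field_simp
  rw [h4, pow_succ]
  have := Real.pi_ne_zero
  field_simp

end Analytic

/-! ### Cosine integrals of functions of bounded variation -/

section BoundedVariation

open Real

lemma BoundedVariationOn.intervalIntegrable {G : ℝ → ℝ} {α β : ℝ} (hαβ : α ≤ β)
    (hG : BoundedVariationOn G (Icc α β)) : IntervalIntegrable G volume α β := by
  obtain ⟨p, q, hp, hq, rfl⟩ :=
    hG.locallyBoundedVariationOn.exists_monotoneOn_sub_monotoneOn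
  rw [← uIcc_of_le hαβ] at hp hq
  exact hp.intervalIntegrable.sub hq.intervalIntegrable

/-- The range lies within half the variation of the midpoint of its infimum and supremum. -/
lemma BoundedVariationOn.exists_abs_sub_le {G : ℝ → ℝ} {α β : ℝ} (hαβ : α ≤ β)
    (hG : BoundedVariationOn G (Icc α β)) :
    ∃ c : ℝ, ∀ x ∈ Icc α β, |G x - c| ≤ (eVariationOn G (Icc α β)).toReal / 2 := by
  set v := (eVariationOn G (Icc α β)).toReal
  have hle : ∀ x ∈ Icc α β, ∀ y ∈ Icc α β, G x ≤ G y + v := fun x hx y hy => by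
    have := hG.sub_le hx hy
    linarith
  have hα : α ∈ Icc α β := left_mem_Icc.2 hαβ
  have hne : (G '' Icc α β).Nonempty := ⟨_, α, hα, rfl⟩
  have hbelow : BddBelow (G '' Icc α β) := ⟨G α - v, by
    rintro _ ⟨y, hy, rfl⟩
    have := hle α hα y hy
    linarith⟩
  have habove : BddAbove (G '' Icc α β) := ⟨G α + v, by
    rintro _ ⟨x, hx, rfl⟩
    exact hle x hx α hα⟩
  have hosc : sSup (G '' Icc α β) ≤ sInf (G '' Icc α β) + v := by
    refine csSup_le hne ?_
    rintro _ ⟨x, hx, rfl⟩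
    rw [← sub_le_iff_le_add]
    refine le_csInf hne ?_
    rintro _ ⟨y, hy, rfl⟩
    have := hle x hx y hy
    linarith
  refine ⟨(sSup (G '' Icc α β) + sInf (G '' Icc α β)) / 2, fun x hx => ?_⟩
  have h1 := le_csSup habove ⟨x, hx, rfl⟩
  have h2 := csInf_le hbelow ⟨x, hx, rfl⟩
  exact abs_le.2 ⟨by linarith, by linarith⟩

lemma integral_abs_cos_mul {k : ℝ} (hk : 0 < k) (α : ℝ) :
    ∫ θ in α..(α + π / k), |cos (k * θ)| = 2 / k := by
  have hper : Function.Periodic (fun θ => |cos θ|) π := fun θ => by simp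
  have h1 := intervalIntegral.integral_comp_mul_left (a := α) (b := α + π / k)
    (fun θ => |cos θ|) hk.ne'
  have h2 : k * (α + π / k) = k * α + π := by field_simp
  rw [h1, h2, hper.intervalIntegral_add_eq (k * α) (-(π / 2)),
    show -(π / 2) + π = π / 2 by ring]
  have h3 : ∫ θ in -(π / 2)..(π / 2), |cos θ| = ∫ θ in -(π / 2)..(π / 2), cos θ := by
    refine intervalIntegral.integral_congr fun θ hθ => ?_
    rw [uIcc_of_le (by linarith [pi_pos])] at hθ
    exact abs_of_nonneg (cos_nonneg_of_mem_Icc hθ)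
  rw [h3, integral_cos, sin_neg, sin_pi_div_two, smul_eq_mul]
  field_simp
  norm_num

/-- Over a half period between zeros of `sin (k θ)` the integral of `cos (k θ)` vanishes, so the
function may be replaced by its deviation from the middle of its range. -/
lemma abs_integral_mul_cos_le_of_half_period {G : ℝ → ℝ} {k : ℝ} (hk : 0 < k) {α : ℝ}
    (hα : sin (k * α) = 0) (hG : BoundedVariationOn G (Icc α (α + π / k))) :
    |∫ θ in α..(α + π / k), G θ * cos (k * θ)| ≤
      (eVariationOn G (Icc α (α + π / k))).toReal / k := by
  have hle : α ≤ α + π / k := by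
    have := div_pos pi_pos hk
    linarith
  obtain ⟨c, hc⟩ := hG.exists_abs_sub_le hle
  set v := (eVariationOn G (Icc α (α + π / k))).toReal
  have hcos : Continuous fun θ => cos (k * θ) := by fun_prop
  have hGi := hG.intervalIntegrable hle
  have hzero : ∫ θ in α..(α + π / k), cos (k * θ) = 0 := by
    rw [intervalIntegral.integral_comp_mul_left (fun θ => cos θ) hk.ne', integral_cos,
      show k * (α + π / k) = k * α + π by field_simp, sin_add_pi, hα]
    simp
  have heq : ∫ θ in α..(α + π / k), G θ * cos (k * θ) =
      ∫ θ in α..(α + π / k), (G θ - c) * cos (k * θ) := by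
    simp only [sub_mul]
    rw [intervalIntegral.integral_sub (hGi.mul_continuousOn hcos.continuousOn)
      ((hcos.const_mul c).intervalIntegrable _ _), intervalIntegral.integral_const_mul, hzero,
      mul_zero, sub_zero]
  rw [heq, ← Real.norm_eq_abs]
  calc ‖∫ θ in α..(α + π / k), (G θ - c) * cos (k * θ)‖
      ≤ ∫ θ in α..(α + π / k), v / 2 * |cos (k * θ)| := by
        refine intervalIntegral.norm_integral_le_of_norm_le hle
          (Filter.Eventually.of_forall fun θ hθ => ?_)
          ((hcos.abs.const_mul _).intervalIntegrable _ _)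
        rw [norm_mul, Real.norm_eq_abs, Real.norm_eq_abs]
        exact mul_le_mul_of_nonneg_right (hc θ (Ioc_subset_Icc_self hθ)) (abs_nonneg _)
    _ = v / k := by
        rw [intervalIntegral.integral_const_mul, integral_abs_cos_mul hk]
        field_simp

/-- Decay of the cosine coefficients of a function of bounded variation, with the sharp
constant. -/
lemma abs_integral_mul_cos_le {G : ℝ → ℝ} (hG : BoundedVariationOn G (Icc (-π) 0)) {k : ℕ}
    (hk : 1 ≤ k) :
    |∫ θ in (-π)..0, G θ * cos (k * θ)| ≤ (eVariationOn G (Icc (-π) 0)).toReal / k := by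
  have hk0 : (0 : ℝ) < k := by exact_mod_cast hk
  let t : ℕ → ℝ := fun j => -π + j * (π / k)
  have ht0 : t 0 = -π := by simp [t]
  have htk : t k = 0 := by simp only [t]; field_simp; ring
  have htsucc : ∀ j, t (j + 1) = t j + π / k := fun j => by simp only [t]; push_cast; ring
  have hstep : 0 < π / k := div_pos pi_pos hk0
  have htmono : Monotone t := monotone_nat_of_le_succ fun j => by rw [htsucc]; linarith
  have hsin : ∀ j, sin (k * t j) = 0 := by
    intro j
    rw [show (k : ℝ) * t j = ((j - k : ℤ) : ℝ) * π by simp only [t]; push_cast; field_simp; ring]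
    exact sin_int_mul_pi _
  have hsub : ∀ {i j : ℕ}, j ≤ k → Icc (t i) (t j) ⊆ Icc (-π) 0 := fun {i j} hj =>
    Icc_subset_Icc (ht0 ▸ htmono (Nat.zero_le i)) (htk ▸ htmono hj)
  have hcos : Continuous fun θ => cos (k * θ) := by fun_prop
  have key : ∀ j ≤ k, |∫ θ in (t 0)..(t j), G θ * cos (k * θ)| ≤
      (eVariationOn G (Icc (t 0) (t j))).toReal / k := by
    intro j
    induction j with
    | zero =>
      intro _
      rw [intervalIntegral.integral_same, abs_zero]
      positivity
    | succ j ih =>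
      intro hj
      have h1 := ih (by omega)
      have hb1 : BoundedVariationOn G (Icc (t 0) (t j)) := hG.mono (hsub (by omega))
      have hb2 : BoundedVariationOn G (Icc (t j) (t (j + 1))) := hG.mono (hsub hj)
      have hle1 : t 0 ≤ t j := htmono (Nat.zero_le j)
      have hle2 : t j ≤ t (j + 1) := htmono (Nat.le_succ j)
      have h2 : |∫ θ in (t j)..(t (j + 1)), G θ * cos (k * θ)| ≤
          (eVariationOn G (Icc (t j) (t (j + 1)))).toReal / k := by
        rw [htsucc] at hb2 ⊢
        exact abs_integral_mul_cos_le_of_half_period hk0 (hsin j) hb2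
      have hadd := eVariationOn.Icc_add_Icc G (s := univ) hle1 hle2 (mem_univ _)
      simp only [univ_inter] at hadd
      rw [← intervalIntegral.integral_add_adjacent_intervals
        ((hb1.intervalIntegrable hle1).mul_continuousOn hcos.continuousOn)
        ((hb2.intervalIntegrable hle2).mul_continuousOn hcos.continuousOn), ← hadd,
        ENNReal.toReal_add hb1 hb2, add_div]
      exact (abs_add_le _ _).trans (add_le_add h1 h2)
  have := key k le_rfl
  rwa [ht0, htk] at this

end BoundedVariation

/-! ### Reciprocals of descending factorials -/

section DescFactorial

lemma one_div_descFactorial_succ {n p : ℕ} (hp : 1 ≤ p) (hpn : p ≤ n) :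
    1 / ((n + 1).descFactorial (p + 1) : ℝ) =
      1 / p * (1 / (n.descFactorial p : ℝ) - 1 / ((n + 1).descFactorial p : ℝ)) := by
  have hX : (0 : ℝ) < n.descFactorial p := by exact_mod_cast Nat.descFactorial_pos.2 hpn
  have hY : (0 : ℝ) < (n + 1).descFactorial p := by
    exact_mod_cast Nat.descFactorial_pos.2 (by omega)
  have hp' : (0 : ℝ) < p := by exact_mod_cast hp
  have h1 : ((n + 1).descFactorial (p + 1) : ℝ) = (n + 1) * n.descFactorial p := by
    exact_mod_cast Nat.succ_descFactorial_succ n p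
  have h2 : ((n + 1).descFactorial (p + 1) : ℝ) = (n + 1 - p) * (n + 1).descFactorial p := by
    rw [Nat.descFactorial_succ, Nat.cast_mul, Nat.cast_sub (by omega)]
    push_cast
    ring
  rw [h1]
  rw [h1] at h2
  field_simp
  linear_combination h2

/-- The tail sum `∑_{k > N} 1 / (k (k - 1) ⋯ (k - p))` telescopes. -/
lemma exists_hasSum_one_div_descFactorial {N p : ℕ} (hp : 1 ≤ p) (hpN : p ≤ N) :
    ∃ S : ℝ, HasSum (fun j : ℕ => 1 / ((N + 1 + j).descFactorial (p + 1) : ℝ)) S ∧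
      S ≤ 1 / (p * (N.descFactorial p : ℝ)) := by
  have hpos : ∀ j : ℕ, (0 : ℝ) ≤ 1 / ((N + 1 + j).descFactorial (p + 1) : ℝ) :=
    fun j => by positivity
  have hpart : ∀ M : ℕ, ∑ j ∈ Finset.range M, 1 / ((N + 1 + j).descFactorial (p + 1) : ℝ) =
      1 / p * (1 / (N.descFactorial p : ℝ) - 1 / ((N + M).descFactorial p : ℝ)) := by
    intro M
    induction M with
    | zero => simp
    | succ M ih =>
      rw [Finset.sum_range_succ, ih, show N + 1 + M = N + M + 1 by ring,
        one_div_descFactorial_succ hp (by omega : p ≤ N + M), ← add_assoc N M 1]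
      ring
  have hle : ∀ M : ℕ, ∑ j ∈ Finset.range M, 1 / ((N + 1 + j).descFactorial (p + 1) : ℝ) ≤
      1 / (p * (N.descFactorial p : ℝ)) := by
    intro M
    have h1 : (0 : ℝ) ≤ 1 / p * (1 / ((N + M).descFactorial p : ℝ)) := by positivity
    have h2 : 1 / (p * (N.descFactorial p : ℝ)) = 1 / p * (1 / (N.descFactorial p : ℝ)) := by
      rw [one_div_mul_one_div]
    rw [hpart, h2, mul_sub]
    linarith
  exact ⟨_, (summable_of_sum_range_le hpos hle).hasSum, Real.tsum_le_of_sum_range_le hpos hle⟩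

lemma sub_pow_le_descFactorial {N p : ℕ} (hpN : p < N) :
    ((N : ℝ) - p) ^ p ≤ N.descFactorial p := by
  have h1 : ((N + 1 - p : ℕ) : ℝ) ^ p ≤ N.descFactorial p := by
    exact_mod_cast Nat.pow_sub_le_descFactorial N p
  have h2 : ((N + 1 - p : ℕ) : ℝ) = N + 1 - p := by
    rw [Nat.cast_sub (by omega)]
    push_cast
    ring
  have h3 : (0 : ℝ) ≤ N - p := by
    have : (p : ℝ) < N := by exact_mod_cast hpN
    linarith
  rw [h2] at h1
  exact (pow_le_pow_left₀ h3 (by linarith) p).trans h1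

end DescFactorial

/-! ### Integration by parts for the cosine coefficients -/

section Composition

/-- Precomposition with a monotone Lipschitz map. Monotonicity keeps the images of disjoint
intervals disjoint. -/
lemma AbsolutelyContinuousOnInterval.comp_monotoneOn {f φ : ℝ → ℝ} {a b c d : ℝ} (hab : a ≤ b)
    (hcd : c ≤ d) (hf : AbsolutelyContinuousOnInterval f a b) (hφ : MonotoneOn φ (Icc c d))
    (hmaps : MapsTo φ (Icc c d) (Icc a b)) {K : ℝ} (hK : 0 < K)
    (hlip : ∀ x y, dist (φ x) (φ y) ≤ K * dist x y) :
    AbsolutelyContinuousOnInterval (fun θ => f (φ θ)) c d := by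
  rw [absolutelyContinuousOnInterval_iff] at hf ⊢
  intro ε hε
  obtain ⟨δ, hδ, h⟩ := hf ε hε
  refine ⟨δ / K, div_pos hδ hK, fun E hE hsum => ?_⟩
  obtain ⟨hmem, hdisj⟩ := hE
  rw [uIcc_of_le hcd] at hmem
  refine h (E.1, fun i => (φ (E.2 i).1, φ (E.2 i).2)) ⟨fun i hi => ?_, fun i hi j hj hij => ?_⟩ ?_
  · rw [uIcc_of_le hab]
    exact ⟨hmaps (hmem i hi).1, hmaps (hmem i hi).2⟩
  · obtain ⟨hi1, hi2⟩ := hmem i hi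
    obtain ⟨hj1, hj2⟩ := hmem j hj
    have h1 := hdisj hi hj hij
    simp only [Function.onFun, uIoc, Ioc_disjoint_Ioc] at h1 ⊢
    have mmax : ∀ {x y : ℝ}, x ∈ Icc c d → y ∈ Icc c d → max x y ∈ Icc c d := fun hx hy =>
      ⟨le_max_of_le_left hx.1, max_le hx.2 hy.2⟩
    have mmin : ∀ {x y : ℝ}, x ∈ Icc c d → y ∈ Icc c d → min x y ∈ Icc c d := fun hx hy =>
      ⟨le_min hx.1 hy.1, min_le_of_left_le hx.2⟩
    rw [← hφ.map_max hi1 hi2, ← hφ.map_max hj1 hj2, ← hφ.map_min hi1 hi2, ← hφ.map_min hj1 hj2,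
      ← hφ.map_min (mmax hi1 hi2) (mmax hj1 hj2), ← hφ.map_max (mmin hi1 hi2) (mmin hj1 hj2)]
    exact hφ (mmin (mmax hi1 hi2) (mmax hj1 hj2)) (mmax (mmin hi1 hi2) (mmin hj1 hj2)) h1
  · rw [lt_div_iff₀ hK, mul_comm, Finset.mul_sum] at hsum
    exact (Finset.sum_le_sum fun i _ => hlip _ _).trans_lt hsum

end Composition

section Interval

open Real

variable {a b : ℝ}

lemma affineMapTo_mem_Icc (hab : a < b) {x : ℝ} (hx : x ∈ Icc (-1 : ℝ) 1) :
    affineMapTo a b x ∈ Icc a b := by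
  obtain ⟨h1, h2⟩ := hx
  constructor <;> rw [affineMapTo] <;> nlinarith

lemma affineMapInv_mem_Icc (hab : a < b) {x : ℝ} (hx : x ∈ Icc a b) :
    affineMapInv a b x ∈ Icc (-1 : ℝ) 1 := by
  have h0 : 0 < b - a := sub_pos.2 hab
  have h1 : 2 * (b - x) / (b - a) ≤ 2 := by
    rw [div_le_iff₀ h0]
    linarith [hx.1]
  have h2 : 0 ≤ 2 * (b - x) / (b - a) := div_nonneg (by linarith [hx.2]) h0.le
  exact ⟨by rw [affineMapInv]; linarith, by rw [affineMapInv]; linarith⟩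

lemma affineMapTo_affineMapInv (hab : a < b) (x : ℝ) :
    affineMapTo a b (affineMapInv a b x) = x := by
  have h0 : b - a ≠ 0 := (sub_pos.2 hab).ne'
  rw [affineMapTo, affineMapInv]
  field_simp
  ring

lemma affineMapInv_affineMapTo (hab : a < b) (x : ℝ) :
    affineMapInv a b (affineMapTo a b x) = x := by
  have h0 : b - a ≠ 0 := (sub_pos.2 hab).ne'
  rw [affineMapTo, affineMapInv]
  field_simp
  ring

lemma continuous_affineMapTo : Continuous (affineMapTo a b) := by
  unfold affineMapTo
  fun_prop

lemma hasDerivAt_affineMapTo_cos (θ : ℝ) :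
    HasDerivAt (fun θ => affineMapTo a b (cos θ)) (-((b - a) / 2 * sin θ)) θ := by
  have h1 := (((hasDerivAt_cos θ).const_sub 1).const_mul ((a - b) / 2)).const_add b
  unfold affineMapTo
  exact h1.congr_deriv (by ring)

lemma monotoneOn_affineMapTo_cos (hab : a < b) :
    MonotoneOn (fun θ => affineMapTo a b (cos θ)) (Icc (-π) 0) := by
  intro x hx y hy hxy
  have h1 : cos x ≤ cos y := by
    rw [← cos_neg x, ← cos_neg y]
    exact cos_le_cos_of_nonneg_of_le_pi (by linarith [hy.2]) (by linarith [hx.1]) (by linarith)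
  simp only [affineMapTo]
  nlinarith

lemma dist_affineMapTo_cos_le (hab : a < b) (x y : ℝ) :
    dist (affineMapTo a b (cos x)) (affineMapTo a b (cos y)) ≤ (b - a) / 2 * dist x y := by
  rw [Real.dist_eq, Real.dist_eq, show affineMapTo a b (cos x) - affineMapTo a b (cos y) =
    (b - a) / 2 * (cos x - cos y) by simp only [affineMapTo]; ring, abs_mul,
    abs_of_pos (by linarith : 0 < (b - a) / 2)]
  exact mul_le_mul_of_nonneg_left (abs_cos_sub_cos_le x y) (by linarith)

lemma mapsTo_affineMapTo_cos (hab : a < b) (s : Set ℝ) :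
    MapsTo (fun θ => affineMapTo a b (cos θ)) s (Icc a b) :=
  fun θ _ => affineMapTo_mem_Icc hab (cos_mem_Icc θ)

/-- The substitution `x = τ (cos θ)` pulls null sets back to null sets, because its inverse
`-(arccos ∘ τ⁻¹)` is differentiable on the open interval. -/
lemma ae_comp_affineMapTo_cos (hab : a < b) {p : ℝ → Prop} (hp : ∀ᵐ x, x ∈ Icc a b → p x) :
    ∀ᵐ θ, θ ∈ uIoc (-π) 0 → p (affineMapTo a b (cos θ)) := by
  let S : Set ℝ := {x | ¬(x ∈ Icc a b → p x)}
  let ψ : ℝ → ℝ := fun x => -arccos (affineMapInv a b x)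
  have hψ : DifferentiableOn ℝ ψ (S ∩ {x | affineMapInv a b x ≠ -1 ∧ affineMapInv a b x ≠ 1}) := by
    intro x hx
    have h1 : DifferentiableAt ℝ (affineMapInv a b) x := by
      unfold affineMapInv
      fun_prop
    exact ((differentiableAt_arccos.2 hx.2).comp x h1).neg.differentiableWithinAt
  have hnull := addHaar_image_eq_zero_of_differentiableOn_of_addHaar_eq_zero volume hψ
    (measure_mono_null inter_subset_left (ae_iff.1 hp))
  have hzero : ∀ᵐ θ : ℝ, θ ≠ 0 := by simp [ae_iff]
  filter_upwards [compl_mem_ae_iff.2 hnull, hzero] with θ hθ hθ0 hmem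
  rw [uIoc_of_le (by linarith [pi_pos])] at hmem
  have hlt : θ < 0 := lt_of_le_of_ne hmem.2 hθ0
  by_contra hnot
  have hinv : affineMapInv a b (affineMapTo a b (cos θ)) = cos θ := affineMapInv_affineMapTo hab _
  refine hθ ⟨affineMapTo a b (cos θ), ⟨fun h => hnot (h (affineMapTo_mem_Icc hab (cos_mem_Icc θ))),
    ?_, ?_⟩, ?_⟩
  · rw [hinv, ← cos_pi, ← cos_neg θ]
    intro h
    have := injOn_cos ⟨by linarith, by linarith [hmem.1]⟩ ⟨pi_pos.le, le_rfl⟩ h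
    linarith [hmem.1]
  · rw [hinv, ← cos_zero, ← cos_neg θ]
    intro h
    have := injOn_cos ⟨by linarith, by linarith [hmem.1]⟩ ⟨le_rfl, pi_pos.le⟩ h
    linarith
  · simp only [ψ]
    rw [hinv, ← cos_neg θ, arccos_cos (by linarith) (by linarith [hmem.1]), neg_neg]

/-- Integration by parts, with `2 sin θ sin (k θ) = cos ((k - 1) θ) - cos ((k + 1) θ)`:
differentiating the function gains a factor of order `1 / k`. -/
lemma cosCoeff_eq_of_absolutelyContinuous (hab : a < b) {f f' : ℝ → ℝ}
    (hf : AbsolutelyContinuousOnInterval f a b)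
    (hf' : ∀ᵐ x, x ∈ Icc a b → HasDerivAt f (f' x) x)
    (hint : IntervalIntegrable (fun θ => f' (affineMapTo a b (cos θ))) volume (-π) 0) (l : ℕ) :
    cosCoeff (fun x => f (affineMapTo a b x)) (l + 1) =
      (b - a) / 2 / (2 * (l + 1)) * (cosCoeff (fun x => f' (affineMapTo a b x)) l -
        cosCoeff (fun x => f' (affineMapTo a b x)) (l + 2)) := by
  have hl : (l : ℝ) + 1 ≠ 0 := by positivity
  have hac : AbsolutelyContinuousOnInterval (fun θ => f (affineMapTo a b (cos θ))) (-π) 0 :=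
    hf.comp_monotoneOn (φ := fun θ => affineMapTo a b (cos θ)) hab.le (by linarith [pi_pos])
      (monotoneOn_affineMapTo_cos hab) (mapsTo_affineMapTo_cos hab _)
      (by linarith : 0 < (b - a) / 2) (dist_affineMapTo_cos_le hab)
  let v : ℝ → ℝ := fun θ => sin ((l + 1) * θ) / (l + 1)
  have hv : ∀ θ, HasDerivAt v (cos ((l + 1) * θ)) θ := by
    intro θ
    have h1 := (((hasDerivAt_id θ).const_mul ((l : ℝ) + 1)).sin).div_const ((l : ℝ) + 1)
    exact h1.congr_deriv (by simp only [id]; field_simp)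
  have hvac : AbsolutelyContinuousOnInterval v (-π) 0 := by
    refine ContDiffOn.absolutelyContinuousOnInterval (ContDiff.contDiffOn ?_)
    exact (contDiff_sin.comp (contDiff_const.mul contDiff_id)).div_const _
  have hparts := hac.integral_mul_deriv_eq_deriv_mul hvac
  have hv0 : v 0 = 0 := by simp [v]
  have hvpi : v (-π) = 0 := by
    have : sin ((l + 1) * -π) = 0 := by
      have := sin_int_mul_pi (-(l + 1))
      push_cast at this
      rw [← this]
      congr 1
      ring
    simp only [v, this, zero_div]
  rw [hv0, hvpi, mul_zero, mul_zero, sub_zero, zero_sub] at hparts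
  have hderiv : ∫ θ in (-π)..0, deriv (fun θ => f (affineMapTo a b (cos θ))) θ * v θ =
      ∫ θ in (-π)..0, -((b - a) / 2 / (2 * (l + 1))) *
        (f' (affineMapTo a b (cos θ)) * cos (l * θ) -
          f' (affineMapTo a b (cos θ)) * cos ((l + 2 : ℕ) * θ)) := by
    refine intervalIntegral.integral_congr_ae ?_
    filter_upwards [ae_comp_affineMapTo_cos hab hf'] with θ hθ hmem
    have h1 : HasDerivAt (fun θ => f (affineMapTo a b (cos θ)))
        (f' (affineMapTo a b (cos θ)) * -((b - a) / 2 * sin θ)) θ :=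
      (hθ hmem).comp θ (hasDerivAt_affineMapTo_cos θ)
    have h2 : cos (l * θ) - cos ((l + 2 : ℕ) * θ) = 2 * (sin ((l + 1) * θ) * sin θ) := by
      have e1 : (l : ℝ) * θ = (l + 1) * θ - θ := by ring
      have e2 : ((l + 2 : ℕ) : ℝ) * θ = (l + 1) * θ + θ := by push_cast; ring
      rw [e1, e2, cos_sub, cos_add]
      ring
    rw [h1.deriv, ← mul_sub, h2]
    simp only [v]
    field_simp
  have hcos : ∀ c : ℝ, ContinuousOn (fun θ => cos (c * θ)) (uIcc (-π) 0) := fun c => by fun_prop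
  have hleft : cosCoeff (fun x => f (affineMapTo a b x)) (l + 1) =
      ∫ θ in (-π)..0, f (affineMapTo a b (cos θ)) * deriv v θ := by
    rw [cosCoeff]
    refine intervalIntegral.integral_congr fun θ _ => ?_
    simp only [(hv θ).deriv]
    push_cast
    rfl
  rw [hleft, hparts, hderiv, intervalIntegral.integral_const_mul,
    intervalIntegral.integral_sub (hint.mul_continuousOn (hcos _))
      (hint.mul_continuousOn (hcos _)), cosCoeff, cosCoeff]
  ring

lemma AbsolutelyContinuousOnInterval.continuousOn_comp_affineMapTo (hab : a < b) {f : ℝ → ℝ}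
    (hf : AbsolutelyContinuousOnInterval f a b) :
    ContinuousOn (fun x => f (affineMapTo a b x)) (Icc (-1) 1) := by
  have h1 := hf.continuousOn
  rw [uIcc_of_le hab.le] at h1
  exact h1.comp continuous_affineMapTo.continuousOn fun x hx => affineMapTo_mem_Icc hab hx

/-- Decay of the Chebyshev coefficients of `D 0`, where `D k` is the `k`-th derivative and `D p` is
almost everywhere equal to a function of bounded variation. The integrability of `D 0` after the
substitution is carried along for the integration by parts. -/
lemma abs_cosCoeff_le_of_boundedVariation (hab : a < b) {g : ℝ → ℝ} {C : NNReal}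
    (hg : eVariationOn g (Icc a b) ≤ C) (p : ℕ) : ∀ D : ℕ → ℝ → ℝ,
    (∀ k < p, AbsolutelyContinuousOnInterval (D k) a b) →
    (∀ k < p, ∀ᵐ x, x ∈ Icc a b → HasDerivAt (D k) (D (k + 1) x) x) →
    (∀ᵐ x, x ∈ Icc a b → D p x = g x) →
    IntervalIntegrable (fun θ => D 0 (affineMapTo a b (cos θ))) volume (-π) 0 ∧
    ∀ k, p < k → |cosCoeff (fun x => D 0 (affineMapTo a b x)) k| ≤
      ((b - a) / 2) ^ p * C / (k.descFactorial (p + 1) : ℝ) := by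
  induction p with
  | zero =>
    intro D _ _ hD
    have hae := ae_comp_affineMapTo_cos hab hD
    have hvar : eVariationOn (fun θ => g (affineMapTo a b (cos θ))) (Icc (-π) 0) ≤ C :=
      (eVariationOn.comp_le_of_monotoneOn g (fun θ => affineMapTo a b (cos θ))
        (monotoneOn_affineMapTo_cos hab) (mapsTo_affineMapTo_cos hab _)).trans hg
    have hbv : BoundedVariationOn (fun θ => g (affineMapTo a b (cos θ))) (Icc (-π) 0) :=
      (hvar.trans_lt ENNReal.coe_lt_top).ne
    refine ⟨(hbv.intervalIntegrable (by linarith [pi_pos])).congr_ae ?_, fun k hk => ?_⟩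
    · refine (ae_restrict_iff' measurableSet_uIoc).2 ?_
      filter_upwards [hae] with θ hθ hmem
      exact (hθ hmem).symm
    · have h1 : cosCoeff (fun x => D 0 (affineMapTo a b x)) k =
          ∫ θ in (-π)..0, g (affineMapTo a b (cos θ)) * cos (k * θ) := by
        refine intervalIntegral.integral_congr_ae ?_
        filter_upwards [hae] with θ hθ hmem
        rw [hθ hmem]
      have h2 : (eVariationOn (fun θ => g (affineMapTo a b (cos θ))) (Icc (-π) 0)).toReal ≤ C :=
        ENNReal.toReal_mono ENNReal.coe_ne_top hvar
      rw [h1, pow_zero, one_mul, zero_add, Nat.descFactorial_one]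
      exact (abs_integral_mul_cos_le hbv hk).trans (by gcongr)
  | succ p ih =>
    intro D hac hderiv hD
    obtain ⟨hint, hbound⟩ := ih (fun k => D (k + 1)) (fun k hk => hac (k + 1) (by omega))
      (fun k hk => hderiv (k + 1) (by omega)) hD
    have hac0 := hac 0 (by omega)
    refine ⟨?_, fun k hk => ?_⟩
    · exact (continuous_comp_cos
        (hac0.continuousOn_comp_affineMapTo hab)).intervalIntegrable _ _
    · obtain ⟨l, rfl⟩ : ∃ l, k = l + 1 := ⟨k - 1, by omega⟩
      rw [cosCoeff_eq_of_absolutelyContinuous hab hac0 (hderiv 0 (by omega)) hint l]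
      have h1 := hbound l (by omega)
      have h2 := hbound (l + 2) (by omega)
      have hr : 0 < (b - a) / 2 := by linarith
      have hpos : (0 : ℝ) < l.descFactorial (p + 1) := by
        exact_mod_cast Nat.descFactorial_pos.2 (by omega)
      have hmono : (l.descFactorial (p + 1) : ℝ) ≤ (l + 2).descFactorial (p + 1) := by
        exact_mod_cast Nat.descFactorial_le (p + 1) (by omega)
      have h3 := h2.trans (div_le_div_of_nonneg_left (by positivity) hpos hmono)
      have hfac : ((l + 1).descFactorial (p + 1 + 1) : ℝ) = (l + 1) * l.descFactorial (p + 1) := by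
        exact_mod_cast Nat.succ_descFactorial_succ l (p + 1)
      rw [hfac, abs_mul, abs_of_pos (by positivity : 0 < (b - a) / 2 / (2 * ((l : ℝ) + 1)))]
      calc (b - a) / 2 / (2 * ((l : ℝ) + 1)) *
            |cosCoeff (fun x => D (0 + 1) (affineMapTo a b x)) l -
              cosCoeff (fun x => D (0 + 1) (affineMapTo a b x)) (l + 2)|
          ≤ (b - a) / 2 / (2 * ((l : ℝ) + 1)) *
            (((b - a) / 2) ^ p * C / (l.descFactorial (p + 1) : ℝ) +
              ((b - a) / 2) ^ p * C / (l.descFactorial (p + 1) : ℝ)) := by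
            gcongr
            exact (abs_sub _ _).trans (add_le_add h1 h3)
        _ = ((b - a) / 2) ^ (p + 1) * C / ((l + 1) * l.descFactorial (p + 1)) := by
            rw [pow_succ]
            field_simp
            ring

/-- Chebyshev interpolation of a function whose `p`-th derivative is of bounded variation. -/
theorem abs_sub_interpolate_le_of_boundedVariation (hab : a < b) {V : ℝ → ℝ} {p N : ℕ}
    {C : NNReal} (hp : 1 ≤ p) (hpN : p < N) (hV : HasDerivOfBoundedVariation a b V p C) {x : ℝ}
    (hx : x ∈ Icc (-1 : ℝ) 1) :
    |V (affineMapTo a b x) - (Lagrange.interpolate Finset.univ (chebyshevPoint N)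
      (fun k => V (affineMapTo a b (chebyshevPoint N k)))).eval x| ≤
      4 * (C : ℝ) / (π * p) * ((b - a) / (2 * ((N : ℝ) - p))) ^ p := by
  obtain ⟨hac, g, hg, hvar⟩ := hV
  have hae : ∀ᵐ x, x ∈ Icc a b → iteratedDerivWithin p V (Icc a b) x = g x :=
    (ae_restrict_iff' measurableSet_Icc).1 hg
  have hderiv : ∀ k < p, ∀ᵐ x, x ∈ Icc a b → HasDerivAt (iteratedDerivWithin k V (Icc a b))
      (iteratedDerivWithin (k + 1) V (Icc a b) x) x := by
    intro k hk
    filter_upwards [(hac k hk).ae_differentiableAt] with x h hmem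
    rw [iteratedDerivWithin_succ,
      (h (uIcc_of_le hab.le ▸ hmem)).derivWithin (uniqueDiffOn_Icc hab x hmem)]
    exact (h (uIcc_of_le hab.le ▸ hmem)).hasDerivAt
  obtain ⟨-, hcoef⟩ := abs_cosCoeff_le_of_boundedVariation hab hvar p
    (fun k => iteratedDerivWithin k V (Icc a b)) hac hderiv hae
  have hV0 := hac 0 (by omega)
  simp only [iteratedDerivWithin_zero] at hcoef hV0
  obtain ⟨S, hS, hSle⟩ := exists_hasSum_one_div_descFactorial hp hpN.le
  set r := (b - a) / 2 with hr
  have hrpos : 0 < r := by rw [hr]; linarith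
  have hS' : HasSum (fun j : ℕ => r ^ p * C / ((N + 1 + j).descFactorial (p + 1) : ℝ))
      (r ^ p * C * S) := by
    simpa only [mul_one_div] using hS.mul_left (r ^ p * C)
  have h1 := abs_sub_interpolate_le (hV0.continuousOn_comp_affineMapTo hab) (by omega : 1 ≤ N)
    (fun k hk => hcoef k (by omega)) hS' hx
  have hp0 : (0 : ℝ) < p := by exact_mod_cast hp
  have hNp : (0 : ℝ) < N - p := by
    have : (p : ℝ) < N := by exact_mod_cast hpN
    linarith
  have hS2 : S ≤ 1 / (p * ((N : ℝ) - p) ^ p) := by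
    refine hSle.trans (one_div_le_one_div_of_le (by positivity) ?_)
    exact mul_le_mul_of_nonneg_left (sub_pow_le_descFactorial hpN) hp0.le
  refine h1.trans ?_
  calc 4 / π * (r ^ p * C * S) ≤ 4 / π * (r ^ p * C * (1 / (p * ((N : ℝ) - p) ^ p))) := by gcongr
    _ = 4 * (C : ℝ) / (π * p) * ((b - a) / (2 * ((N : ℝ) - p))) ^ p := by
        rw [← div_div (b - a), ← hr, div_pow r]
        field_simp

end Interval

/-! ### Interpolated exposures -/

lemma abs_realizedExposures_sub_le {f g : ℝ → ℝ} {n : ℕ} {z : Fin n → ℝ} {i : Fin n} {ε : ℝ}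
    (h : |f (z i) - g (z i)| ≤ ε) :
    |realizedExposures f z i - realizedExposures g z i| ≤ ε :=
  (abs_max_sub_max_le_abs _ _ _).trans h

lemma differentiableAt_comp_affineMapToC {a b ϱ : ℝ} {W : ℂ → ℂ}
    (hW : AnalyticOnNhd ℂ W (generalizedBernsteinEllipse a b ϱ)) {w : ℂ}
    (hw : w ∈ bernsteinEllipse ϱ) : DifferentiableAt ℂ (fun w => W (affineMapToC a b w)) w := by
  have h1 : DifferentiableAt ℂ (affineMapToC a b) w := by
    unfold affineMapToC
    fun_prop
  exact (hW _ ⟨w, hw, rfl⟩).differentiableAt.comp w h1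

lemma affineMapToC_ofReal (a b x : ℝ) : affineMapToC a b x = (affineMapTo a b x : ℝ) := by
  simp [affineMapToC, affineMapTo]

theorem corollary1p3 {Ω : Type*} [MeasurableSpace Ω] (P : MeasureTheory.Measure Ω)
    [MeasureTheory.IsProbabilityMeasure P] (hP : IsAtomless P)
    (𝒳 : Set (Ω →ₘ[P] ℝ)) (h𝒳 : (MeasureTheory.Lp ℝ ⊤ P : Set (Ω →ₘ[P] ℝ)) ⊆ 𝒳)
    (ρ : ExposureMeasure P 𝒳) (hρ : ρ.IsLawInvariant) (hρ_finite : ρ.toFun 0 ≠ ⊤)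
    (a b : ℝ) (hab : a < b) (V : ℝ → ℝ) (N : ℕ) (hN : 1 ≤ N)
    (n : ℕ) (hn : 1 ≤ n) (z : Fin n → ℝ) (hz : ∀ i, z i ∈ Set.Icc a b) :
    (∀ (ϱ : ℝ) (W : ℂ → ℂ) (C : ℝ), 1 < ϱ →
      AnalyticOnNhd ℂ W (generalizedBernsteinEllipse a b ϱ) →
      (∀ t ∈ Set.Icc a b, W (t : ℂ) = (V t : ℂ)) →
      (∀ w ∈ generalizedBernsteinEllipse a b ϱ, ‖W w‖ ≤ C) →
      ∃ r s : ℝ,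
        ρ.empirical (realizedExposures V z) = (r : WithTop ℝ) ∧
        ρ.empirical (realizedExposures (chebyshevInterpolant a b N V) z) = (s : WithTop ℝ) ∧
        |r - s| ≤ 4 * C * (ϱ⁻¹ ^ N / (ϱ - 1))) ∧
    (∀ (p : ℕ) (C : NNReal), 1 ≤ p → p < N →
      HasDerivOfBoundedVariation a b V p C →
      ∃ r s : ℝ,
        ρ.empirical (realizedExposures V z) = (r : WithTop ℝ) ∧
        ρ.empirical (realizedExposures (chebyshevInterpolant a b N V) z) = (s : WithTop ℝ) ∧
        |r - s| ≤ 4 * (C : ℝ) / (Real.pi * p) * ((b - a) / (2 * ((N : ℝ) - p))) ^ p) := by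
  refine ⟨fun ϱ W C hϱ hW hWV hWC => ?_, fun p C hp hpN hV => ?_⟩
  · refine ρ.exists_abs_empirical_sub_le hP h𝒳 hρ hρ_finite hn fun i =>
      abs_realizedExposures_sub_le ?_
    have h := abs_sub_interpolate_le_of_analytic (h := fun x => V (affineMapTo a b x)) hϱ
      (fun w hw => differentiableAt_comp_affineMapToC hW hw)
      (fun x hx => by rw [affineMapToC_ofReal, hWV _ (affineMapTo_mem_Icc hab hx)])
      (fun w hw => hWC _ ⟨w, hw, rfl⟩) hN (affineMapInv_mem_Icc hab (hz i))
    simpa only [affineMapTo_affineMapInv hab, chebyshevInterpolant] using h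
  · refine ρ.exists_abs_empirical_sub_le hP h𝒳 hρ hρ_finite hn fun i =>
      abs_realizedExposures_sub_le ?_
    have h := abs_sub_interpolate_le_of_boundedVariation hab hp hpN hV
      (affineMapInv_mem_Icc hab (hz i))
    simpa only [affineMapTo_affineMapInv hab, chebyshevInterpolant] using h
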